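/- Let $\Omega$ be either a smooth bounded domain $U\subset\mathbb R^3$ or the flat torus $\mathbb T=\mathbb R^3/\mathbb Z^3$, and let $T,\alpha,c>0$. Let $\mathbf V$ be the closure in $H^1(\Omega)^3$ of the divergence-free vector fields in $C_c^\infty(\Omega)^3$, let $\mathbf u_0\in\mathbf V$ and $\mathbf f\in L^2(0,T;\mathbf L^2)$, where $\mathbf L^2=L^2(\Omega)^3$, with inner product $(\cdot,\cdot)$. Consider the quasi-relativistic Navier–Stokes problem $$\partial_t\mathbf u-\alpha\Delta\mathbf u+\Big(\frac{c\,\mathbf u}{\sqrt{c^2+|\mathbf u|^2}}\cdot\nabla\Big)\mathbf u+\nabla p=\mathbf f,\qquad \nabla\cdot\mathbf u=0,\qquad \mathbf u(0)=\mathbf u_0,\qquad \mathbf u|_{\partial\Omega}=0 .$$ A strong solution is a function $$\mathbf u\in L^2(0,T;\mathbf H^2)\cap L^\infty(0,T;\mathbf V)\quad\text{with weak time derivative}\quad \mathbf u'\in L^2(0,T;\mathbf L^2),$$ (taken to be its representative in $C([0,T];\mathbf L^2)$), such that $\mathbf u(0)=\mathbf u_0$ and, for almost every $t\in(0,T)$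 and all $\mathbf v\in\mathbf V$, $$(\mathbf u',\mathbf v)+\alpha\sum_{i=1}^3\int_\Omega\nabla u_i\cdot\nabla v_i\,dx+\sum_{i,j=1}^3\int_\Omega\frac{c\,u_j\,(\partial_ju_i)\,v_i}{\sqrt{c^2+|\mathbf u|^2}}\,dx=(\mathbf f,\mathbf v).$$ **Proposition.** The strong solution is unique: if $\mathbf u_1$ and $\mathbf u_2$ are strong solutions with the same data $\mathbf u_0$ and $\mathbf f$, then $\mathbf u_1(t)=\mathbf u_2(t)$ in $\mathbf L^2$ for all $0\le t\le T$. -/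

import Mathlib

open MeasureTheory
open scoped ContDiff ENNReal

noncomputable section

namespace QRNS

/-- Points of space and vectors in it, with the Euclidean norm. -/
abbrev Vec : Type := EuclideanSpace ℝ (Fin 3)

/-- Gradients of vector fields: the entry `(i, j)` is `∂_j u_i`; the norm is
`(∑ i j, |∂_j u_i| ^ 2) ^ (1 / 2)`. -/
abbrev Mat : Type := EuclideanSpace ℝ (Fin 3 × Fin 3)

/-- Second derivatives of vector fields: the entry `(i, j, k)` is `∂_k ∂_j u_i`. -/
abbrev Ten : Type := EuclideanSpace ℝ (Fin 3 × Fin 3 × Fin 3)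

/-- A smooth bounded domain of `ℝ³`: nonempty, open, connected, bounded, and near each boundary
point it is a sublevel set of a smooth function whose differential does not vanish there. -/
structure IsSmoothBoundedDomain (U : Set Vec) : Prop where
  isOpen : IsOpen U
  isConnected : IsConnected U
  isBounded : Bornology.IsBounded U
  smooth_boundary : ∀ x ∈ frontier U, ∃ N ∈ nhds x, ∃ ρ : Vec → ℝ,
    ContDiff ℝ ∞ ρ ∧ fderiv ℝ ρ x ≠ 0 ∧ ∀ y ∈ N, (y ∈ U ↔ ρ y < 0)

/-- The domain `Ω` occupied by the fluid: a smooth bounded domain of `ℝ³` or the flat torus. -/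
inductive FluidDomain : Type
  | bounded (U : Set Vec) (hU : IsSmoothBoundedDomain U) : FluidDomain
  | torus : FluidDomain

namespace FluidDomain

/-- The underlying set. The torus `ℝ³ / ℤ³` is represented by the unit cube; functions on the
torus are functions on the cube, and the smooth ones are those of `IsTest` below. -/
def carrier : FluidDomain → Set Vec
  | bounded U _ => U
  | torus => {x | ∀ i, x i ∈ Set.Ico (0 : ℝ) 1}

/-- The volume measure on `Ω`. -/
def measure (Ω : FluidDomain) : Measure Vec := volume.restrict Ω.carrier

/-- `C_c^∞(Ω)`: the smooth functions with compact support in `U`, respectively the smooth functions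
on the (compact) torus, i.e. the smooth functions on `ℝ³` of period `1` in each coordinate. -/
def IsTest {F : Type} [NormedAddCommGroup F] [NormedSpace ℝ F] :
    FluidDomain → (Vec → F) → Prop
  | bounded U _, φ => ContDiff ℝ ∞ φ ∧ HasCompactSupport φ ∧ tsupport φ ⊆ U
  | torus, φ => ContDiff ℝ ∞ φ ∧ ∀ (x : Vec) (i : Fin 3), φ (x + EuclideanSpace.single i 1) = φ x

/-- The space `L²(Ω; F)`; for `F = Vec` this is the space of square integrable vector fields. -/
abbrev L2 (Ω : FluidDomain) (F : Type) [NormedAddCommGroup F] : Type := Lp F 2 Ω.measure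

end FluidDomain

/-- The classical partial derivative `∂_j φ`. -/
def partialDeriv {F : Type} [NormedAddCommGroup F] [NormedSpace ℝ F]
    (j : Fin 3) (φ : Vec → F) (x : Vec) : F :=
  fderiv ℝ φ x (EuclideanSpace.single j 1)

/-- The classical gradient of a vector field. -/
def grad (φ : Vec → Vec) (x : Vec) : Mat :=
  WithLp.toLp 2 fun p : Fin 3 × Fin 3 => partialDeriv p.2 φ x p.1

/-- The classical divergence of a vector field. -/
def div (φ : Vec → Vec) (x : Vec) : ℝ := ∑ i, partialDeriv i φ x i

/-- The pairs `(φ, ∇φ)` for divergence free `φ ∈ C_c^∞(Ω)³`, as elements of `L² × L²`. -/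
def smoothSolenoidal (Ω : FluidDomain) : Set (Ω.L2 Vec × Ω.L2 Mat) :=
  {p | ∃ φ : Vec → Vec, Ω.IsTest φ ∧ (∀ x, div φ x = 0) ∧
    p.1 =ᵐ[Ω.measure] φ ∧ p.2 =ᵐ[Ω.measure] grad φ}

/-- The pairs `(v, ∇v)` for `v ∈ V`, where `V` is the `H¹`-closure of the divergence free fields in
`C_c^∞(Ω)³`. Convergence of `φₙ` in `H¹` is convergence of `(φₙ, ∇φₙ)` in `L² × L²`. -/
def graphV (Ω : FluidDomain) : Set (Ω.L2 Vec × Ω.L2 Mat) := closure (smoothSolenoidal Ω)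

/-- The space `V`, as a set of square integrable vector fields. -/
def V (Ω : FluidDomain) : Set (Ω.L2 Vec) := {v | ∃ G : Ω.L2 Mat, (v, G) ∈ graphV Ω}

/-- `h` is the weak partial derivative `∂_j g` on `Ω`. -/
def IsWeakPartial (Ω : FluidDomain) (j : Fin 3) (g h : Vec → ℝ) : Prop :=
  ∀ φ : Vec → ℝ, Ω.IsTest φ →
    ∫ x, g x * partialDeriv j φ x ∂Ω.measure = -∫ x, h x * φ x ∂Ω.measure

/-- Lebesgue measure on the time interval `(0, T)`. -/
def timeMeasure (T : ℝ) : Measure ℝ := volume.restrict (Set.Ioo 0 T)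

/-- `u ∈ L^p(0, T; V)`, and `G` is its (spatial) gradient. -/
structure MemLpV (Ω : FluidDomain) (T : ℝ) (p : ℝ≥0∞) (u : ℝ → Ω.L2 Vec) (G : ℝ → Ω.L2 Mat) :
    Prop where
  memLp : MemLp u p (timeMeasure T)
  memLp_grad : MemLp G p (timeMeasure T)
  mem_graph : ∀ᵐ t ∂timeMeasure T, (u t, G t) ∈ graphV Ω

/-- `u ∈ L^p(0, T; H²)`: the field `u(t)` has weak first and second derivatives in `L²(Ω)`, for
almost every `t`, and these are in `L^p(0, T; L²)`. -/
def MemLpH2 (Ω : FluidDomain) (T : ℝ) (p : ℝ≥0∞) (u : ℝ → Ω.L2 Vec) : Prop :=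
  ∃ (G : ℝ → Ω.L2 Mat) (K : ℝ → Ω.L2 Ten),
    MemLp u p (timeMeasure T) ∧ MemLp G p (timeMeasure T) ∧ MemLp K p (timeMeasure T) ∧
    ∀ᵐ t ∂timeMeasure T,
      (∀ i j, IsWeakPartial Ω j (fun x => u t x i) (fun x => G t x (i, j))) ∧
      (∀ i j k, IsWeakPartial Ω k (fun x => G t x (i, j)) (fun x => K t x (i, j, k)))

/-- `u'` is the weak time derivative of `u` on `(0, T)`, both with values in `L²(Ω; ℝ³)`. -/
def IsWeakTimeDeriv (Ω : FluidDomain) (T : ℝ) (u u' : ℝ → Ω.L2 Vec) : Prop :=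
  ∀ w : ℝ → ℝ, ContDiff ℝ ∞ w → HasCompactSupport w → tsupport w ⊆ Set.Ioo 0 T →
    ∫ t, deriv w t • u t ∂timeMeasure T = -∫ t, w t • u' t ∂timeMeasure T

/-- The form `A[u, v] = α ∑ i, ∫ ∇u_i · ∇v_i`, in terms of `G = ∇u` and `Gv = ∇v`. -/
def formA (Ω : FluidDomain) (α : ℝ) (G Gv : Ω.L2 Mat) : ℝ :=
  α * ∑ i, ∫ x, ∑ j, G x (i, j) * Gv x (i, j) ∂Ω.measure

/-- The form `B[y, u, v] = ∫ ((c y / √(c² + |y|²)) · ∇) u · v`, in terms of `G = ∇u`. -/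
def formB (Ω : FluidDomain) (c : ℝ) (y : Ω.L2 Vec) (G : Ω.L2 Mat) (v : Ω.L2 Vec) : ℝ :=
  ∫ x, ∑ i, ∑ j, c * y x j * G x (i, j) * v x i / √(c ^ 2 + ‖y x‖ ^ 2) ∂Ω.measure

/-- `u` is a strong solution on `[0, T]` of the quasi-relativistic Navier-Stokes equations with
viscosity `α`, speed of light `c`, force `f` and initial velocity `u₀`: a weak solution with
`u ∈ L²(0, T; H²) ∩ L^∞(0, T; V)` and `u' ∈ L²(0, T; L²)`.
Since `u` and `u'` are in `L²(0, T; L²)`, after a modification on a null set `u` is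
continuous from `[0, T]` to `L²`; here `u` is this representative, which gives a meaning to the
initial condition. -/
structure IsStrongSolution (Ω : FluidDomain) (T α c : ℝ) (f : ℝ → Ω.L2 Vec) (u₀ : Ω.L2 Vec)
    (u : ℝ → Ω.L2 Vec) : Prop where
  continuousOn : ContinuousOn u (Set.Icc 0 T)
  initial : u 0 = u₀
  memLpH2 : MemLpH2 Ω T 2 u
  weak_form : ∃ (G : ℝ → Ω.L2 Mat) (u' : ℝ → Ω.L2 Vec),
    MemLpV Ω T ∞ u G ∧
    MemLp u' 2 (timeMeasure T) ∧ IsWeakTimeDeriv Ω T u u' ∧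
    ∀ᵐ t ∂timeMeasure T, ∀ (v : Ω.L2 Vec) (Gv : Ω.L2 Mat), (v, Gv) ∈ graphV Ω →
      inner ℝ (u' t) v + formA Ω α (G t) Gv + formB Ω c (u t) (G t) v = inner ℝ (f t) v

end QRNS

end

/-! This is an energy estimate for `w = u₁ - u₂`. Testing the difference of the two equations with
`w` gives `½ d/dt ‖w‖² + α ‖∇w‖² = -(B[u₁, u₁, w] - B[u₂, u₂, w])`. The velocity `a(y) = c y / √(c²
+ |y|²)` is bounded by `c` and 2-Lipschitz, so splitting the difference as `(a(u₁)·∇)w + ((a(u₁) -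
a(u₂))·∇)u₂` bounds the right side by `c ‖∇w‖ ‖w‖ + 2 ∫ |w|² |∇u₂|` (`abs_formB_sub_le`).

By Hölder, interpolation and the Sobolev embedding of `V` in `L⁶`, the last integral is at most a
constant times `‖w‖^(1/2) ‖w‖_{H¹}^(3/2) ‖∇u₂‖` (`exists_integral_sq_mul_le`). Since `∇u₂` is in
`L^∞(0, T; L²)`, Young's inequality absorbs all gradients of `w` into the viscous term
(`add_le_of_sq_le`). What remains is `d/dt ‖w‖² ≤ 2 K ‖w‖²` with `w(0) = 0`, and Grönwall gives `w =
0`.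

The time derivative is legitimate because a continuous function with integrable weak derivative is
its primitive (`eq_add_integral_of_weakDeriv`), so `‖w‖²` is absolutely continuous. -/

namespace QRNS
open Filter Topology Set

/-! ### Calculus in time: weak derivatives, absolute continuity, Grönwall. -/

section Time

variable {E : Type*} [NormedAddCommGroup E]

lemma deriv_smoothTransition_of_nonpos {x : ℝ} (hx : x ≤ 0) : deriv Real.smoothTransition x = 0 := by
  refine IsLocalMin.deriv_eq_zero (Filter.Eventually.of_forall fun y => ?_)
  rw [Real.smoothTransition.zero_of_nonpos hx]
  exact Real.smoothTransition.nonneg y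

lemma deriv_smoothTransition_of_one_le {x : ℝ} (hx : 1 ≤ x) : deriv Real.smoothTransition x = 0 := by
  refine IsLocalMax.deriv_eq_zero (Filter.Eventually.of_forall fun y => ?_)
  rw [Real.smoothTransition.one_of_one_le hx]
  exact Real.smoothTransition.le_one y

lemma continuous_deriv_smoothTransition : Continuous (deriv Real.smoothTransition) :=
  (Real.smoothTransition.contDiff (n := 1)).continuous_deriv le_rfl

/-- The derivatives of smooth steps at `a` are an approximate identity at `a`. -/
lemma tendsto_integral_deriv_smoothTransition [NormedSpace ℝ E] [CompleteSpace E] {T a : ℝ}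
    (ha : a ∈ Ioo 0 T) {w : ℝ → E} (hw : ContinuousOn w (Icc 0 T)) :
    Tendsto (fun ε : ℝ => ∫ τ in Ioo 0 T,
        (ε⁻¹ * deriv Real.smoothTransition ((τ - a) / ε)) • w τ) (𝓝[>] 0) (𝓝 (w a)) := by
  have hev : ∀ᶠ ε : ℝ in 𝓝[>] 0, 0 < ε ∧ ε < T - a :=
    Ioo_mem_nhdsGT (by linarith [ha.2])
  have hmem : ∀ ε : ℝ, 0 < ε ∧ ε < T - a → ∀ r ∈ Icc (0 : ℝ) 1, ε * r + a ∈ Icc 0 T := by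
    rintro ε ⟨h0, h1⟩ r ⟨hr0, hr1⟩
    have := mul_nonneg h0.le hr0
    have := mul_le_mul_of_nonneg_left hr1 h0.le
    constructor <;> linarith [ha.1]
  -- The substitution `τ = ε r + a` turns the kernel into a fixed density on `[0, 1]`, of total mass
  -- one.
  have heq : (fun ε : ℝ => ∫ r in (0 : ℝ)..1, deriv Real.smoothTransition r • w (ε * r + a))
      =ᶠ[𝓝[>] 0] fun ε : ℝ => ∫ τ in Ioo 0 T,
        (ε⁻¹ * deriv Real.smoothTransition ((τ - a) / ε)) • w τ := by
    filter_upwards [hev] with ε hε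
    have h1 : ∫ τ in Ioo 0 T, (ε⁻¹ * deriv Real.smoothTransition ((τ - a) / ε)) • w τ
        = ∫ τ in a..(ε + a), (ε⁻¹ * deriv Real.smoothTransition ((τ - a) / ε)) • w τ := by
      rw [intervalIntegral.integral_of_le (by linarith [hε.1])]
      refine setIntegral_eq_of_subset_of_forall_sdiff_eq_zero measurableSet_Ioo ?_ ?_
      · intro x hx
        exact ⟨ha.1.trans hx.1, by linarith [hx.2, hε.2]⟩
      · intro x hx
        by_cases hxa : x ≤ a
        · rw [deriv_smoothTransition_of_nonpos, mul_zero, zero_smul]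
          exact div_nonpos_of_nonpos_of_nonneg (by linarith) hε.1.le
        · rw [deriv_smoothTransition_of_one_le, mul_zero, zero_smul]
          rw [le_div_iff₀ hε.1]
          by_contra hcon
          exact hx.2 ⟨by linarith, by linarith⟩
    have h2 := intervalIntegral.smul_integral_comp_mul_add (a := 0) (b := 1)
      (fun τ => (ε⁻¹ * deriv Real.smoothTransition ((τ - a) / ε)) • w τ) ε a
    simp only [mul_zero, zero_add, mul_one] at h2
    rw [h1, ← h2, ← intervalIntegral.integral_smul]
    congr 1 with r
    rw [smul_smul, ← mul_assoc, mul_inv_cancel₀ hε.1.ne', one_mul, add_sub_cancel_right,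
      mul_div_cancel_left₀ _ hε.1.ne']
  refine Tendsto.congr' heq ?_
  obtain ⟨M, hM⟩ := isCompact_Icc.exists_bound_of_continuousOn hw
  obtain ⟨D, hD⟩ := (isCompact_Icc (a := (0 : ℝ)) (b := 1)).exists_bound_of_continuousOn
    continuous_deriv_smoothTransition.continuousOn
  have hlim : w a = ∫ r in (0 : ℝ)..1, deriv Real.smoothTransition r • w a := by
    rw [intervalIntegral.integral_smul_const, intervalIntegral.integral_deriv_eq_sub]
    · simp
    · exact fun x _ => (Real.smoothTransition.contDiff (n := 1)).differentiable (by simp) x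
    · exact continuous_deriv_smoothTransition.intervalIntegrable _ _
  rw [hlim]
  refine intervalIntegral.tendsto_integral_filter_of_dominated_convergence (fun _ => D * M) ?_ ?_
    intervalIntegrable_const ?_
  · filter_upwards [hev] with ε hε
    refine ContinuousOn.aestronglyMeasurable ?_ measurableSet_uIoc
    refine ContinuousOn.mono ?_ uIoc_subset_uIcc
    rw [uIcc_of_le zero_le_one]
    exact continuous_deriv_smoothTransition.continuousOn.smul
      (hw.comp (by fun_prop) (hmem ε hε))
  · filter_upwards [hev] with ε hε
    refine Eventually.of_forall fun r hr => ?_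
    rw [uIoc_of_le zero_le_one] at hr
    have hr' := Ioc_subset_Icc_self hr
    rw [norm_smul]
    exact mul_le_mul (hD r hr') (hM _ (hmem ε hε r hr')) (norm_nonneg _)
      ((norm_nonneg _).trans (hD r hr'))
  · refine Eventually.of_forall fun r hr => Tendsto.const_smul ?_ _
    have hca : ContinuousAt w a := hw.continuousAt (Icc_mem_nhds ha.1 ha.2)
    have : Tendsto (fun ε : ℝ => ε * r + a) (𝓝[>] 0) (𝓝 a) := by
      have h : Tendsto (fun ε : ℝ => ε * r + a) (𝓝 0) (𝓝 (0 * r + a)) :=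
        Continuous.tendsto (by fun_prop) 0
      rw [zero_mul, zero_add] at h
      exact h.mono_left nhdsWithin_le_nhds
    exact hca.tendsto.comp this

/-- The limit is `0` at `x = 0`; hence two steps subtract to the indicator of a half-open interval
`(s, t]`. -/
lemma tendsto_smoothTransition_div (x : ℝ) :
    Tendsto (fun ε : ℝ => Real.smoothTransition (x / ε)) (𝓝[>] 0)
      (𝓝 (if 0 < x then 1 else 0)) := by
  split_ifs with hx
  · refine tendsto_const_nhds.congr' ?_
    filter_upwards [Ioo_mem_nhdsGT hx] with ε hε
    rw [Real.smoothTransition.one_of_one_le]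
    rw [le_div_iff₀ hε.1]
    linarith [hε.2]
  · refine tendsto_const_nhds.congr' ?_
    filter_upwards [self_mem_nhdsWithin] with ε hε
    rw [Real.smoothTransition.zero_of_nonpos]
    exact div_nonpos_of_nonpos_of_nonneg (not_lt.1 hx) (le_of_lt hε)

/-- Test with the difference of smooth steps at `s` and `t`: as the width `ε` shrinks, `η` tends to
the indicator of `(s, t]`, and `η'` to a unit mass at `s` minus one at `t`. -/
lemma sub_eq_integral_of_weakDeriv_of_lt [NormedSpace ℝ E] [CompleteSpace E] {T : ℝ} {w w' : ℝ → E}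
    (hw : ContinuousOn w (Icc 0 T)) (hw' : IntegrableOn w' (Ioo 0 T))
    (h : ∀ η : ℝ → ℝ, ContDiff ℝ ∞ η → HasCompactSupport η → tsupport η ⊆ Ioo 0 T →
      ∫ t in Ioo 0 T, deriv η t • w t = -∫ t in Ioo 0 T, η t • w' t)
    {s t : ℝ} (hs : s ∈ Ioo 0 T) (ht : t ∈ Ioo 0 T) (hst : s ≤ t) :
    w t - w s = ∫ τ in s..t, w' τ := by
  set η : ℝ → ℝ → ℝ := fun ε τ =>
    Real.smoothTransition ((τ - s) / ε) - Real.smoothTransition ((τ - t) / ε) with hη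
  have hS : ContDiff ℝ ∞ Real.smoothTransition := Real.smoothTransition.contDiff
  have hSd : ∀ x, HasDerivAt Real.smoothTransition (deriv Real.smoothTransition x) x :=
    fun x => (hS.differentiable (by simp) x).hasDerivAt
  have hev : ∀ᶠ ε : ℝ in 𝓝[>] 0, 0 < ε ∧ ε < T - t :=
    Ioo_mem_nhdsGT (by linarith [ht.2])
  have hsm : ∀ ε, ContDiff ℝ ∞ (η ε) := fun ε =>
    (hS.comp (by fun_prop)).sub (hS.comp (by fun_prop))
  have hder : ∀ ε τ, deriv (η ε) τ = ε⁻¹ * deriv Real.smoothTransition ((τ - s) / ε) -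
      ε⁻¹ * deriv Real.smoothTransition ((τ - t) / ε) := by
    intro ε τ
    have key : ∀ a, HasDerivAt (fun τ => Real.smoothTransition ((τ - a) / ε))
        (ε⁻¹ * deriv Real.smoothTransition ((τ - a) / ε)) τ := by
      intro a
      have h1 : HasDerivAt (fun τ : ℝ => (τ - a) / ε) (1 / ε) τ :=
        ((hasDerivAt_id τ).sub_const a).div_const ε
      have h2 := (hSd ((τ - a) / ε)).comp τ h1
      rw [one_div, mul_comm] at h2
      exact h2
    exact ((key s).sub (key t)).deriv
  have hsupp : ∀ ε, 0 < ε ∧ ε < T - t → tsupport (η ε) ⊆ Icc s (t + ε) := by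
    intro ε hε
    refine closure_minimal ?_ isClosed_Icc
    intro x hx
    by_contra hcon
    refine hx ?_
    simp only [hη]
    by_cases hxs : s ≤ x
    · have hxt : t + ε < x := by
        by_contra hh
        exact hcon ⟨hxs, not_lt.1 hh⟩
      rw [Real.smoothTransition.one_of_one_le, Real.smoothTransition.one_of_one_le, sub_self] <;>
        rw [le_div_iff₀ hε.1] <;> linarith
    · rw [Real.smoothTransition.zero_of_nonpos, Real.smoothTransition.zero_of_nonpos, sub_self] <;>
        exact div_nonpos_of_nonpos_of_nonneg (by linarith) hε.1.le
  have hint : ∀ ε a : ℝ, IntegrableOn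
      (fun τ => (ε⁻¹ * deriv Real.smoothTransition ((τ - a) / ε)) • w τ) (Ioo 0 T) := by
    intro ε a
    refine IntegrableOn.mono_set (ContinuousOn.integrableOn_compact isCompact_Icc ?_)
      Ioo_subset_Icc_self
    refine ContinuousOn.smul (Continuous.continuousOn ?_) hw
    exact continuous_const.mul (continuous_deriv_smoothTransition.comp (by fun_prop))
  have hL : Tendsto (fun ε => ∫ τ in Ioo 0 T, deriv (η ε) τ • w τ) (𝓝[>] 0) (𝓝 (w s - w t)) := by
    refine Tendsto.congr (fun ε => ?_) ((tendsto_integral_deriv_smoothTransition hs hw).sub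
      (tendsto_integral_deriv_smoothTransition ht hw))
    rw [← integral_sub (hint ε s) (hint ε t)]
    simp only [hder, sub_smul]
  have hR : Tendsto (fun ε => ∫ τ in Ioo 0 T, η ε τ • w' τ) (𝓝[>] 0)
      (𝓝 (∫ τ in Ioo 0 T, (Ioc s t).indicator w' τ)) := by
    refine tendsto_integral_filter_of_dominated_convergence (fun τ => ‖w' τ‖) ?_ ?_ hw'.norm ?_
    · exact Eventually.of_forall fun ε =>
        (hsm ε).continuous.aestronglyMeasurable.smul hw'.aestronglyMeasurable
    · refine Eventually.of_forall fun ε => Eventually.of_forall fun τ => ?_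
      rw [norm_smul]
      refine mul_le_of_le_one_left (norm_nonneg _) ?_
      rw [Real.norm_eq_abs, abs_le]
      simp only [hη]
      constructor <;> linarith [Real.smoothTransition.nonneg ((τ - s) / ε),
        Real.smoothTransition.le_one ((τ - s) / ε), Real.smoothTransition.nonneg ((τ - t) / ε),
        Real.smoothTransition.le_one ((τ - t) / ε)]
    · refine Eventually.of_forall fun τ => ?_
      have h1 := ((tendsto_smoothTransition_div (τ - s)).sub
        (tendsto_smoothTransition_div (τ - t))).smul_const (w' τ)
      convert h1 using 2
      by_cases hτs : s < τ
      · by_cases hτt : t < τ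
        · simp [hτs, hτt]
        · simp [hτs, hτt, not_lt.1 hτt]
      · have hτt : ¬ t < τ := by linarith
        simp [hτs, hτt]
  have hE : (fun ε => ∫ τ in Ioo 0 T, deriv (η ε) τ • w τ) =ᶠ[𝓝[>] 0]
      fun ε => -∫ τ in Ioo 0 T, η ε τ • w' τ := by
    filter_upwards [hev] with ε hε
    refine h (η ε) (hsm ε) ?_ ?_
    · exact isCompact_Icc.of_isClosed_subset (isClosed_tsupport _) (hsupp ε hε)
    · exact (hsupp ε hε).trans (Icc_subset_Ioo hs.1 (by linarith [hε.2]))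
  have hlim := tendsto_nhds_unique hL (hR.neg.congr' hE.symm)
  rw [← neg_sub, hlim, neg_neg, setIntegral_indicator measurableSet_Ioc,
    intervalIntegral.integral_of_le hst]
  congr 2
  exact inter_eq_right.2 fun x hx => ⟨hs.1.trans hx.1, hx.2.trans_lt ht.2⟩

/-- A continuous function with an integrable weak derivative is the integral of the latter. -/
lemma eq_add_integral_of_weakDeriv [NormedSpace ℝ E] [CompleteSpace E] {T : ℝ} (hT : 0 < T)
    {w w' : ℝ → E}
    (hw : ContinuousOn w (Icc 0 T)) (hw' : IntegrableOn w' (Ioo 0 T))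
    (h : ∀ η : ℝ → ℝ, ContDiff ℝ ∞ η → HasCompactSupport η → tsupport η ⊆ Ioo 0 T →
      ∫ t in Ioo 0 T, deriv η t • w t = -∫ t in Ioo 0 T, η t • w' t) :
    ∀ t ∈ Icc 0 T, w t = w 0 + ∫ τ in (0 : ℝ)..t, w' τ := by
  have hII : IntervalIntegrable w' volume 0 T := by
    rw [intervalIntegrable_iff_integrableOn_Ioo_of_le hT.le]
    exact hw'
  have hsub : ∀ t ∈ Icc 0 T, IntervalIntegrable w' volume 0 t := fun t ht =>
    hII.mono_set (by rw [uIcc_of_le ht.1, uIcc_of_le hT.le]; exact Icc_subset_Icc_right ht.2)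
  set z : ℝ → E := fun t => w t - ∫ τ in (0 : ℝ)..t, w' τ with hz
  have hzc : ContinuousOn z (Icc 0 T) := by
    refine hw.sub ?_
    have := intervalIntegral.continuousOn_primitive_interval'  hII left_mem_uIcc
    rwa [uIcc_of_le hT.le] at this
  have hmid : T / 2 ∈ Ioo 0 T := ⟨by linarith, by linarith⟩
  have hle : ∀ s ∈ Ioo 0 T, ∀ t ∈ Ioo 0 T, s ≤ t → z t = z s := by
    intro s hs t ht hst
    have h1 := sub_eq_integral_of_weakDeriv_of_lt hw hw' h hs ht hst
    rw [← intervalIntegral.integral_interval_sub_left (hsub t (Ioo_subset_Icc_self ht))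
      (hsub s (Ioo_subset_Icc_self hs))] at h1
    simp only [hz]
    rw [sub_eq_sub_iff_sub_eq_sub, h1]
  have hconst : EqOn z (fun _ => z (T / 2)) (Ioo 0 T) := by
    intro t ht
    rcases le_total t (T / 2) with h1 | h1
    · exact (hle _ ht _ hmid h1).symm
    · exact hle _ hmid _ ht h1
  -- Test functions only see the open interval; continuity carries the constancy of `z` to the
  -- endpoints, in particular to the initial time.
  have hcl : EqOn z (fun _ => z (T / 2)) (Icc 0 T) :=
    hconst.of_subset_closure hzc continuousOn_const Ioo_subset_Icc_self
      (by rw [closure_Ioo hT.ne])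
  intro t ht
  have h0 : z 0 = w 0 := by simp [hz]
  have h1 : z t = w 0 := by
    rw [← h0, hcl ht, hcl (left_mem_Icc.2 hT.le)]
  rw [← h1]
  simp [hz]

lemma AbsolutelyContinuousOnInterval.of_dist_le {X Y : Type*} [PseudoMetricSpace X]
    [PseudoMetricSpace Y] {f : ℝ → X} {g : ℝ → Y} {a b : ℝ} (hg : AbsolutelyContinuousOnInterval g a b)
    (h : ∀ x ∈ uIcc a b, ∀ y ∈ uIcc a b, dist (f x) (f y) ≤ dist (g x) (g y)) :
    AbsolutelyContinuousOnInterval f a b := by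
  rw [absolutelyContinuousOnInterval_iff] at hg ⊢
  intro ε hε
  obtain ⟨δ, hδ, H⟩ := hg ε hε
  refine ⟨δ, hδ, fun I hI hI' => lt_of_le_of_lt (Finset.sum_le_sum fun i hi => ?_) (H I hI hI')⟩
  have := hI.1 i hi
  exact h _ this.1 _ this.2

variable [InnerProductSpace ℝ E]

/-- The squared norm of an integral is absolutely continuous. -/
lemma absolutelyContinuousOnInterval_norm_sq {T : ℝ} (hT : 0 < T) {w w' : ℝ → E}
    (hw' : IntervalIntegrable w' volume 0 T)
    (h : ∀ t ∈ Icc 0 T, w t = w 0 + ∫ τ in (0 : ℝ)..t, w' τ) :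
    AbsolutelyContinuousOnInterval (fun t => ‖w t‖ ^ 2) 0 T := by
  have hsub : ∀ t ∈ Icc 0 T, IntervalIntegrable w' volume 0 t := fun t ht =>
    hw'.mono_set (by rw [uIcc_of_le ht.1, uIcc_of_le hT.le]; exact Icc_subset_Icc_right ht.2)
  have hwc : ContinuousOn w (Icc 0 T) := by
    refine ContinuousOn.congr (f := fun t => w 0 + ∫ τ in (0 : ℝ)..t, w' τ) ?_ h
    have := intervalIntegral.continuousOn_primitive_interval' hw' left_mem_uIcc
    rw [uIcc_of_le hT.le] at this
    exact continuousOn_const.add this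
  obtain ⟨M, hM⟩ := isCompact_Icc.exists_bound_of_continuousOn hwc
  -- With `‖w‖ ≤ M`, the increments of `‖w‖²` are at most `2 M` times those of the primitive of
  -- `‖w'‖`.
  have hAC := (hw'.norm.absolutelyContinuousOnInterval_intervalIntegral
    (c := 0) left_mem_uIcc).const_mul (2 * M)
  refine AbsolutelyContinuousOnInterval.of_dist_le hAC ?_
  rw [uIcc_of_le hT.le]
  intro x hx y hy
  have hM0 : 0 ≤ M := (norm_nonneg _).trans (hM x hx)
  have h1 : w x - w y = ∫ τ in y..x, w' τ := by
    rw [h x hx, h y hy, add_sub_add_left_eq_sub,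
      intervalIntegral.integral_interval_sub_left (hsub x hx) (hsub y hy)]
  have h2 : ‖w x - w y‖ ≤ |(∫ τ in (0 : ℝ)..x, ‖w' τ‖) - ∫ τ in (0 : ℝ)..y, ‖w' τ‖| := by
    rw [h1, intervalIntegral.integral_interval_sub_left (hsub x hx).norm (hsub y hy).norm]
    exact intervalIntegral.norm_integral_le_abs_integral_norm
  rw [Real.dist_eq, Real.dist_eq, ← mul_sub, abs_mul, abs_of_nonneg (by positivity : 0 ≤ 2 * M),
    sq_sub_sq, abs_mul, abs_of_nonneg (by positivity)]
  have h3 := hM x hx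
  have h4 := hM y hy
  exact mul_le_mul (by linarith) ((abs_norm_sub_norm_le _ _).trans h2) (abs_nonneg _) (by positivity)

/-- Lebesgue differentiation of the primitive, followed by the chain rule for the squared norm. -/
lemma ae_hasDerivAt_norm_sq [CompleteSpace E] {T : ℝ} (hT : 0 < T) {w w' : ℝ → E}
    (hw' : IntervalIntegrable w' volume 0 T)
    (h : ∀ t ∈ Icc 0 T, w t = w 0 + ∫ τ in (0 : ℝ)..t, w' τ) :
    ∀ᵐ t, t ∈ Ioo 0 T → HasDerivAt (fun t => ‖w t‖ ^ 2) (2 * inner ℝ (w t) (w' t)) t := by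
  filter_upwards [hw'.ae_hasDerivAt_integral] with t ht htT
  have h1 := ht (by rw [uIcc_of_le hT.le]; exact Ioo_subset_Icc_self htT) 0 left_mem_uIcc
  have h2 : HasDerivAt w (w' t) t := by
    refine (h1.const_add (w 0)).congr_of_eventuallyEq ?_
    filter_upwards [Ioo_mem_nhds htT.1 htT.2] with s hs
    exact h s (Ioo_subset_Icc_self hs)
  exact h2.norm_sq

/-- Grönwall's inequality for absolutely continuous functions. -/
lemma nonpos_of_ae_deriv_le {f : ℝ → ℝ} {T K : ℝ} (hT : 0 < T)
    (hf : AbsolutelyContinuousOnInterval f 0 T) (h0 : f 0 = 0)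
    (h : ∀ᵐ t, t ∈ Ioo 0 T → deriv f t ≤ K * f t) : ∀ t ∈ Icc 0 T, f t ≤ 0 := by
  intro t ht
  have hsub : uIcc 0 t ⊆ uIcc 0 T := by
    rw [uIcc_of_le ht.1, uIcc_of_le hT.le]; exact Icc_subset_Icc_right ht.2
  have hft := hf.mono hsub
  -- The integrating factor makes `exp (-K x) * f x` absolutely continuous with derivative a.e.
  -- nonpositive.
  have hexp : AbsolutelyContinuousOnInterval (fun t => Real.exp (-K * t)) 0 t :=
    ContDiffOn.absolutelyContinuousOnInterval (by fun_prop)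
  have hFTC := (hexp.fun_mul hft).integral_deriv_eq_sub
  have hle : ∫ x in (0 : ℝ)..t, deriv (fun x => Real.exp (-K * x) * f x) x ≤ 0 := by
    rw [← neg_nonneg, ← intervalIntegral.integral_neg]
    refine intervalIntegral.integral_nonneg_of_ae_restrict ht.1 ?_
    rw [EventuallyLE, ← Measure.restrict_congr_set Ioo_ae_eq_Icc, ae_restrict_iff' measurableSet_Ioo]
    filter_upwards [h, hf.ae_differentiableAt] with x hx hd hxt
    have hxT : x ∈ Ioo 0 T := ⟨hxt.1, hxt.2.trans_le ht.2⟩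
    have hd' := (hd (by rw [uIcc_of_le hT.le]; exact Ioo_subset_Icc_self hxT)).hasDerivAt
    have he : HasDerivAt (fun x => Real.exp (-K * x)) (Real.exp (-K * x) * -K) x := by
      have := ((hasDerivAt_id x).const_mul (-K)).exp
      simpa using this
    have hm := (he.mul hd').deriv
    simp only [Pi.zero_apply]
    have hm' : deriv (fun x => Real.exp (-K * x) * f x) x =
      Real.exp (-K * x) * -K * f x + Real.exp (-K * x) * deriv f x := hm
    rw [hm']
    have := mul_nonneg (Real.exp_pos (-K * x)).le (sub_nonneg.2 (hx hxT))
    linarith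
  rw [hFTC, h0, mul_zero, sub_zero] at hle
  exact nonpos_of_mul_nonpos_right hle (Real.exp_pos _)

end Time
end QRNS

namespace QRNS
open Filter Topology Set
open scoped NNReal

/-! ### The embedding of `V` in `L⁶`. -/

section Sobolev

/-- Cauchy–Schwarz over the index pairs: the matrix with entries `v_i y_j` has norm `‖v‖ ‖y‖`. -/
lemma abs_sum_mul_mul_le (y : Vec) (G : Mat) (v : Vec) :
    |∑ i, ∑ j, y j * G (i, j) * v i| ≤ ‖y‖ * ‖G‖ * ‖v‖ := by
  have h1 : ∑ i, ∑ j, y j * G (i, j) * v i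
      = ∑ p : Fin 3 × Fin 3, G p * (y p.2 * v p.1) := by
    rw [Fintype.sum_prod_type]
    exact Finset.sum_congr rfl fun i _ => Finset.sum_congr rfl fun j _ => by ring
  have h2 : ∑ p : Fin 3 × Fin 3, (y p.2 * v p.1) ^ 2 = ‖y‖ ^ 2 * ‖v‖ ^ 2 := by
    rw [Fintype.sum_prod_type, EuclideanSpace.real_norm_sq_eq, EuclideanSpace.real_norm_sq_eq,
      mul_comm, Finset.sum_mul_sum]
    exact Finset.sum_congr rfl fun i _ => Finset.sum_congr rfl fun j _ => by ring
  have h3 := Finset.sum_mul_sq_le_sq_mul_sq Finset.univ G (fun p => y p.2 * v p.1)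
  rw [h2, ← EuclideanSpace.real_norm_sq_eq] at h3
  rw [h1]
  refine abs_le_of_sq_le_sq (h3.trans_eq (by ring)) (by positivity)

/-- Operator norm against Hilbert–Schmidt norm: pairing `L v` with itself gives `‖L v‖² ≤ ‖v‖ ‖∇φ‖
‖L v‖`. -/
lemma norm_fderiv_le_norm_grad (φ : Vec → Vec) (x : Vec) : ‖fderiv ℝ φ x‖ ≤ ‖grad φ x‖ := by
  refine ContinuousLinearMap.opNorm_le_bound _ (norm_nonneg _) fun v => ?_
  set L := fderiv ℝ φ x with hL
  have hv : v = ∑ j, v j • EuclideanSpace.single j (1 : ℝ) := by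
    ext i
    simp [Pi.single_apply]
  have hLv : ∀ i, L v i = ∑ j, v j * grad φ x (i, j) := by
    intro i
    conv_lhs => rw [hv]
    simp [map_sum, grad, partialDeriv, hL]
  have h1 : ‖L v‖ ^ 2 = ∑ i, ∑ j, v j * grad φ x (i, j) * L v i := by
    rw [EuclideanSpace.real_norm_sq_eq]
    refine Finset.sum_congr rfl fun i _ => ?_
    rw [← Finset.sum_mul, ← hLv, sq]
  have h2 := (le_abs_self _).trans (abs_sum_mul_mul_le v (grad φ x) (L v))
  rw [← h1] at h2
  by_cases h0 : ‖L v‖ = 0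
  · rw [h0]; positivity
  · have : 0 < ‖L v‖ := lt_of_le_of_ne (norm_nonneg _) (Ne.symm h0)
    rw [mul_comm ‖grad φ x‖]
    nlinarith

lemma continuous_grad {φ : Vec → Vec} (hφ : ContDiff ℝ ∞ φ) : Continuous (grad φ) := by
  refine (PiLp.continuous_toLp 2 _).comp (continuous_pi fun p => ?_)
  have h : Continuous fun x => fderiv ℝ φ x (EuclideanSpace.single p.2 1) :=
    (hφ.continuous_fderiv (by simp)).clm_apply continuous_const
  exact (EuclideanSpace.proj (𝕜 := ℝ) p.1).continuous.comp h

/-- Gagliardo–Nirenberg–Sobolev in dimension 3, where `1/6 = 1/2 - 1/3`. -/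
lemma exists_eLpNorm_six_le_fderiv : ∃ C : ℝ≥0, ∀ φ : Vec → Vec, ContDiff ℝ 1 φ →
    HasCompactSupport φ →
      eLpNorm φ 6 (volume : Measure Vec) ≤ C * eLpNorm (fderiv ℝ φ) 2 (volume : Measure Vec) := by
  refine ⟨SNormLESNormFDerivOfEqConst Vec (volume : Measure Vec) (2 : ℝ≥0), fun φ h1 h2 => ?_⟩
  have := eLpNorm_le_eLpNorm_fderiv_of_eq (volume : Measure Vec) h1 h2 (p := 2) (p' := 6)
    (by norm_num) (by simp) (by simp; norm_num)
  exact_mod_cast this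

/-- The unit cube, a fundamental domain of the torus. -/
def cube : Set Vec := {x | ∀ i, x i ∈ Ico (0 : ℝ) 1}

lemma measurableSet_cube : MeasurableSet cube := by
  have : cube = ⋂ i, (fun x : Vec => x i) ⁻¹' Ico (0 : ℝ) 1 := by
    ext x; simp [cube]
  rw [this]
  exact MeasurableSet.iInter fun i =>
    (EuclideanSpace.proj (𝕜 := ℝ) i).continuous.measurable measurableSet_Ico

/-- The point of the integer lattice with given coordinates. -/
def latticePoint (k : Fin 3 → ℤ) : Vec := WithLp.toLp 2 fun i => (k i : ℝ)

lemma periodic_add_intMul {F : Type*} {g : Vec → F} {i : Fin 3}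
    (h : ∀ x, g (x + EuclideanSpace.single i 1) = g x) (n : ℤ) (x : Vec) :
    g (x + EuclideanSpace.single i (n : ℝ)) = g x := by
  have hp : Function.Periodic g (EuclideanSpace.single i (1 : ℝ)) := h
  have h2 := (hp.zsmul n) x
  have h3 : n • EuclideanSpace.single i (1 : ℝ) = EuclideanSpace.single i (n : ℝ) := by
    ext j
    by_cases hij : j = i <;> simp [hij]
  rw [← h3, h2]

lemma periodic_add_latticePoint {F : Type*} {g : Vec → F}
    (h : ∀ (x : Vec) (i : Fin 3), g (x + EuclideanSpace.single i 1) = g x) (k : Fin 3 → ℤ)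
    (x : Vec) : g (x + latticePoint k) = g x := by
  have : latticePoint k = EuclideanSpace.single 0 (k 0 : ℝ) + EuclideanSpace.single 1 (k 1 : ℝ)
      + EuclideanSpace.single 2 (k 2 : ℝ) := by
    ext j
    fin_cases j <;> simp [latticePoint]
  rw [this, ← add_assoc, ← add_assoc, periodic_add_intMul (h · 2), periodic_add_intMul (h · 1),
    periodic_add_intMul (h · 0)]

/-- The ball is covered by the lattice translates of the cube with coordinates in `[-R, R]`, and `g`
has the same integral on each; `N` counts them. -/
lemma exists_lintegral_periodic_ball_le (R : ℕ) : ∃ N : ℝ≥0, ∀ g : Vec → ℝ≥0∞,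
    (∀ (x : Vec) (i : Fin 3), g (x + EuclideanSpace.single i 1) = g x) →
      ∫⁻ x in Metric.closedBall (0 : Vec) R, g x ≤ N * ∫⁻ x in cube, g x := by
  set F := Fintype.piFinset fun _ : Fin 3 => Finset.Icc (-R : ℤ) R with hF
  refine ⟨F.card, fun g h => ?_⟩
  have hsub : Metric.closedBall (0 : Vec) R ⊆ ⋃ k : F, (fun x => x - latticePoint k) ⁻¹' cube := by
    intro x hx
    simp only [mem_iUnion]
    refine ⟨⟨fun i => ⌊x i⌋, ?_⟩, ?_⟩
    · rw [hF, Fintype.mem_piFinset]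
      intro i
      have hxi : |x i| ≤ R := by
        have := PiLp.norm_apply_le x i
        rw [Real.norm_eq_abs] at this
        exact this.trans (by simpa using hx)
      rw [abs_le] at hxi
      rw [Finset.mem_Icc]
      constructor
      · rw [Int.le_floor]; push_cast; exact hxi.1
      · have := (Int.floor_le (x i)).trans hxi.2
        have h3 : ((⌊x i⌋ : ℤ) : ℝ) ≤ ((R : ℤ) : ℝ) := by push_cast; exact this
        exact Int.cast_le.1 h3
    · intro i
      simp only [latticePoint, PiLp.sub_apply]
      exact ⟨by linarith [Int.floor_le (x i)], by linarith [Int.lt_floor_add_one (x i)]⟩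
  calc ∫⁻ x in Metric.closedBall (0 : Vec) R, g x
      ≤ ∫⁻ x in ⋃ k : F, (fun x => x - latticePoint k) ⁻¹' cube, g x := lintegral_mono_set hsub
    _ ≤ ∑' k : F, ∫⁻ x in (fun x => x - latticePoint k) ⁻¹' cube, g x :=
        lintegral_iUnion_le _ _
    _ = ∑ k ∈ F, ∫⁻ x in (fun x => x - latticePoint k) ⁻¹' cube, g x :=
        F.tsum_subtype fun k => ∫⁻ x in (fun x => x - latticePoint k) ⁻¹' cube, g x
    _ = ∑ k ∈ F, ∫⁻ x in cube, g x := by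
        refine Finset.sum_congr rfl fun k _ => ?_
        have hmp := (measurePreserving_sub_right (volume : Measure Vec)
          (latticePoint k)).setLIntegral_comp_preimage_emb (measurableEmbedding_subRight _) g cube
        refine Eq.trans ?_ hmp
        refine lintegral_congr fun x => ?_
        rw [← periodic_add_latticePoint h k (x - latticePoint k), sub_add_cancel]
    _ = _ := by rw [Finset.sum_const, nsmul_eq_mul, ENNReal.coe_natCast]

lemma grad_periodic {φ : Vec → Vec}
    (h : ∀ (x : Vec) (i : Fin 3), φ (x + EuclideanSpace.single i 1) = φ x) (x : Vec) (i : Fin 3) :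
    grad φ (x + EuclideanSpace.single i 1) = grad φ x := by
  have : fderiv ℝ φ (x + EuclideanSpace.single i 1) = fderiv ℝ φ x := by
    rw [← fderiv_comp_add_right]
    simp only [h]
  simp only [grad, partialDeriv, this]

lemma exists_cutoff : ∃ (χ : Vec → ℝ) (D : ℝ≥0), ContDiff ℝ ∞ χ ∧ tsupport χ ⊆ Metric.closedBall 0 3 ∧
    (∀ x ∈ cube, χ x = 1) ∧ (∀ x, ‖χ x‖ ≤ 1) ∧ ∀ x, ‖fderiv ℝ χ x‖ ≤ D := by
  -- Points of the cube have norm at most `√3 < 2`, so the bump is `1` there.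
  let b : ContDiffBump (0 : Vec) := ⟨2, 3, by norm_num, by norm_num⟩
  have hb : ContDiff ℝ ∞ b := b.contDiff
  obtain ⟨D, hD⟩ := (b.hasCompactSupport.fderiv (𝕜 := ℝ)).exists_bound_of_continuous
    (hb.continuous_fderiv (by simp))
  refine ⟨b, D.toNNReal, hb, by rw [b.tsupport_eq], ?_, ?_, fun x => (hD x).trans (le_max_left _ _)⟩
  · intro x hx
    refine b.one_of_mem_closedBall ?_
    rw [mem_closedBall_zero_iff]
    refine (sq_le_sq₀ (norm_nonneg _) (by norm_num [b])).1 ?_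
    rw [EuclideanSpace.real_norm_sq_eq, Fin.sum_univ_three]
    have h : ∀ i, x i ^ 2 ≤ 1 := fun i => by nlinarith [(hx i).1, (hx i).2]
    have h0 := h 0
    have h1 := h 1
    have h2 := h 2
    norm_num [b]
    linarith
  · intro x
    rw [Real.norm_eq_abs, abs_of_nonneg b.nonneg]
    exact b.le_one

/-- The Sobolev inequality for periodic vector fields. -/
lemma exists_eLpNorm_six_le_periodic : ∃ C : ℝ≥0, ∀ φ : Vec → Vec, ContDiff ℝ ∞ φ →
    (∀ (x : Vec) (i : Fin 3), φ (x + EuclideanSpace.single i 1) = φ x) →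
      eLpNorm φ 6 (volume.restrict cube) ≤
        C * (eLpNorm φ 2 (volume.restrict cube) + eLpNorm (grad φ) 2 (volume.restrict cube)) := by
  obtain ⟨C, hC⟩ := exists_eLpNorm_six_le_fderiv
  obtain ⟨χ, D, hχ, hχs, hχ1, hχle, hχD⟩ := exists_cutoff
  obtain ⟨N, hN⟩ := exists_lintegral_periodic_ball_le 3
  refine ⟨C * (1 + D) * N ^ (1 / 2 : ℝ), fun φ hφ hper => ?_⟩
  -- The cutoff makes the compactly supported inequality applicable; periodicity then brings the
  -- integral over the ball of radius 3 back to the cube.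
  set ψ : Vec → Vec := fun x => χ x • φ x with hψ
  have hψd : ContDiff ℝ ∞ ψ := hχ.smul hφ
  have hψc : HasCompactSupport ψ := by
    refine HasCompactSupport.smul_right (f := χ) (f' := φ) ?_
    exact (isCompact_closedBall _ _).of_isClosed_subset (isClosed_tsupport _) hχs
  set H : Vec → ℝ := fun x => ‖φ x‖ + ‖grad φ x‖ with hH
  have hHper : ∀ (x : Vec) (i : Fin 3), H (x + EuclideanSpace.single i 1) = H x := by
    intro x i
    simp only [hH, hper, grad_periodic hper]
  have hpt : ∀ x, ‖fderiv ℝ ψ x‖ ≤ ((1 + D : ℝ≥0) : ℝ) * ‖(Metric.closedBall (0 : Vec) 3).indicator H x‖ := by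
    intro x
    by_cases hx : x ∈ Metric.closedBall (0 : Vec) 3
    · rw [indicator_of_mem hx]
      have hf : fderiv ℝ ψ x = χ x • fderiv ℝ φ x + (fderiv ℝ χ x).smulRight (φ x) :=
        fderiv_fun_smul (hχ.differentiable (by simp) x) (hφ.differentiable (by simp) x)
      have h1 : ‖χ x • fderiv ℝ φ x‖ ≤ ‖grad φ x‖ := by
        rw [norm_smul]
        exact (mul_le_of_le_one_left (norm_nonneg _) (hχle x)).trans (norm_fderiv_le_norm_grad φ x)
      have h2 : ‖(fderiv ℝ χ x).smulRight (φ x)‖ ≤ D * ‖φ x‖ := by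
        rw [ContinuousLinearMap.norm_smulRight_apply]
        exact mul_le_mul_of_nonneg_right (hχD x) (norm_nonneg _)
      have h3 : ‖H x‖ = ‖φ x‖ + ‖grad φ x‖ := by
        rw [Real.norm_eq_abs, abs_of_nonneg (by positivity)]
      rw [hf, h3]
      refine (norm_add_le _ _).trans ((add_le_add h1 h2).trans ?_)
      push_cast
      have := mul_nonneg D.coe_nonneg (norm_nonneg (grad φ x))
      nlinarith [norm_nonneg (φ x)]
    · have : fderiv ℝ ψ x = 0 := by
        by_contra hne
        refine hx (hχs ?_)
        have h1 : x ∈ tsupport ψ := support_fderiv_subset ℝ hne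
        exact closure_mono (Function.support_smul_subset_left χ φ) h1
      rw [this, norm_zero]
      positivity
  have hball : eLpNorm ((Metric.closedBall (0 : Vec) 3).indicator H) 2 volume
      ≤ (N : ℝ≥0∞) ^ (1 / 2 : ℝ) * eLpNorm H 2 (volume.restrict cube) := by
    rw [eLpNorm_indicator_eq_eLpNorm_restrict Metric.isClosed_closedBall.measurableSet,
      eLpNorm_eq_lintegral_rpow_enorm_toReal (by simp) (by simp),
      eLpNorm_eq_lintegral_rpow_enorm_toReal (by simp) (by simp),
      ENNReal.toReal_ofNat, ← ENNReal.mul_rpow_of_nonneg _ _ (by norm_num)]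
    refine ENNReal.rpow_le_rpow ?_ (by norm_num)
    have := hN (fun x => ‖H x‖ₑ ^ (2 : ℝ)) (fun x i => by simp only [hHper])
    exact_mod_cast this
  have hHle : eLpNorm H 2 (volume.restrict cube) ≤
      eLpNorm φ 2 (volume.restrict cube) + eLpNorm (grad φ) 2 (volume.restrict cube) := by
    rw [← eLpNorm_norm φ, ← eLpNorm_norm (grad φ)]
    exact eLpNorm_add_le hφ.continuous.norm.aestronglyMeasurable
      (continuous_grad hφ).norm.aestronglyMeasurable (by norm_num)
  calc eLpNorm φ 6 (volume.restrict cube)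
      = eLpNorm ψ 6 (volume.restrict cube) := by
        refine eLpNorm_congr_ae ?_
        filter_upwards [ae_restrict_mem measurableSet_cube] with x hx
        simp [hψ, hχ1 x hx]
    _ ≤ eLpNorm ψ 6 volume := eLpNorm_mono_measure _ Measure.restrict_le_self
    _ ≤ C * eLpNorm (fderiv ℝ ψ) 2 volume := hC ψ (hψd.of_le (by simp)) hψc
    _ ≤ C * (((1 + D : ℝ≥0) : ℝ≥0∞) *
          eLpNorm ((Metric.closedBall (0 : Vec) 3).indicator H) 2 volume) := by
        gcongr
        exact eLpNorm_le_nnreal_smul_eLpNorm_of_ae_le_mul (Eventually.of_forall fun x => hpt x) 2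
    _ ≤ C * (((1 + D : ℝ≥0) : ℝ≥0∞) * ((N : ℝ≥0∞) ^ (1 / 2 : ℝ) *
          (eLpNorm φ 2 (volume.restrict cube) + eLpNorm (grad φ) 2 (volume.restrict cube)))) := by
        gcongr
        exact hball.trans (by gcongr)
    _ = _ := by
        rw [ENNReal.coe_mul, ENNReal.coe_mul, ENNReal.coe_rpow_of_nonneg _ (by norm_num)]
        ring

lemma exists_eLpNorm_six_le_isTest (Ω : FluidDomain) : ∃ C : ℝ≥0, ∀ φ : Vec → Vec, Ω.IsTest φ →
    eLpNorm φ 6 Ω.measure ≤ C * (eLpNorm φ 2 Ω.measure + eLpNorm (grad φ) 2 Ω.measure) := by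
  cases Ω with
  | torus =>
    obtain ⟨C, hC⟩ := exists_eLpNorm_six_le_periodic
    exact ⟨C, fun φ hφ => hC φ hφ.1 hφ.2⟩
  | bounded U hU =>
    obtain ⟨C, hC⟩ := exists_eLpNorm_six_le_fderiv
    refine ⟨C, fun φ ⟨hφ, hc, hsupp⟩ => ?_⟩
    change eLpNorm φ 6 (volume.restrict U) ≤
      C * (eLpNorm φ 2 (volume.restrict U) + eLpNorm (grad φ) 2 (volume.restrict U))
    -- The support of `φ` lies in `U`, so the inequality on the whole space loses nothing.
    have hU : eLpNorm (fderiv ℝ φ) 2 (volume.restrict U) = eLpNorm (fderiv ℝ φ) 2 volume := by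
      rw [← eLpNorm_norm (fderiv ℝ φ), ← eLpNorm_norm (fderiv ℝ φ)]
      refine eLpNorm_restrict_eq_of_support_subset fun x hx => hsupp (support_fderiv_subset ℝ ?_)
      exact fun h0 => hx (by simp only [h0, norm_zero])
    have hG : eLpNorm (fderiv ℝ φ) 2 (volume.restrict U) ≤ eLpNorm (grad φ) 2 (volume.restrict U) :=
      eLpNorm_mono (norm_fderiv_le_norm_grad φ)
    calc eLpNorm φ 6 (volume.restrict U)
        ≤ eLpNorm φ 6 volume := eLpNorm_mono_measure _ Measure.restrict_le_self
      _ ≤ C * eLpNorm (fderiv ℝ φ) 2 volume := hC φ (hφ.of_le (by simp)) hc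
      _ ≤ C * (eLpNorm φ 2 (volume.restrict U) + eLpNorm (grad φ) 2 (volume.restrict U)) := by
          rw [← hU]
          exact mul_le_mul_right (hG.trans le_add_self) _

/-- The Sobolev inequality `‖v‖_{L⁶} ≤ C ‖v‖_{H¹}` on the space `V`. -/
lemma exists_eLpNorm_six_le_graphV (Ω : FluidDomain) : ∃ C : ℝ≥0, ∀ p ∈ graphV Ω,
    eLpNorm p.1 6 Ω.measure ≤ C * (‖p.1‖ₑ + ‖p.2‖ₑ) := by
  obtain ⟨C, hC⟩ := exists_eLpNorm_six_le_isTest Ω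
  refine ⟨C, fun p hp => ?_⟩
  obtain ⟨q, hq, hlim⟩ := mem_closure_iff_seq_limit.1 hp
  have h1 : Tendsto (fun n => (q n).1) atTop (𝓝 p.1) := (continuous_fst.tendsto p).comp hlim
  have h2 : Tendsto (fun n => (q n).2) atTop (𝓝 p.2) := (continuous_snd.tendsto p).comp hlim
  -- A subsequence converges a.e., so Fatou's lemma passes the `L⁶` bound to the closure.
  obtain ⟨ns, hns, hae⟩ := (tendstoInMeasure_of_tendsto_Lp h1).exists_seq_tendsto_ae
  have hbound : ∀ n, eLpNorm (q n).1 6 Ω.measure ≤ C * (‖(q n).1‖ₑ + ‖(q n).2‖ₑ) := by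
    intro n
    obtain ⟨φ, hφ, -, e1, e2⟩ := hq n
    rw [Lp.enorm_def, Lp.enorm_def, eLpNorm_congr_ae e1, eLpNorm_congr_ae e1, eLpNorm_congr_ae e2]
    exact hC φ hφ
  have hT : Tendsto (fun n => (C : ℝ≥0∞) * (‖(q (ns n)).1‖ₑ + ‖(q (ns n)).2‖ₑ)) atTop
      (𝓝 (C * (‖p.1‖ₑ + ‖p.2‖ₑ))) := by
    refine ENNReal.Tendsto.const_mul ?_ (Or.inr ENNReal.coe_ne_top)
    exact ((continuous_enorm.tendsto _).comp (h1.comp hns.tendsto_atTop)).add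
      ((continuous_enorm.tendsto _).comp (h2.comp hns.tendsto_atTop))
  calc eLpNorm p.1 6 Ω.measure
      ≤ atTop.liminf fun n => eLpNorm (q (ns n)).1 6 Ω.measure :=
        Lp.eLpNorm_lim_le_liminf_eLpNorm (fun n => Lp.aestronglyMeasurable _) _ hae
    _ ≤ atTop.liminf fun n => (C : ℝ≥0∞) * (‖(q (ns n)).1‖ₑ + ‖(q (ns n)).2‖ₑ) :=
        liminf_le_liminf (Eventually.of_forall fun n => hbound (ns n))
    _ = _ := hT.liminf_eq

end Sobolev
end QRNS

namespace QRNS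
open Filter Topology Set
open scoped NNReal

/-! ### Estimates of the viscous and convective forms. -/

section Forms

lemma sq_lintegral_mul_le {α : Type*} [MeasurableSpace α] {μ : Measure α} {f g : α → ℝ≥0∞}
    (hf : AEMeasurable f μ) (hg : AEMeasurable g μ) :
    (∫⁻ x, f x * g x ∂μ) ^ 2 ≤ (∫⁻ x, f x ^ 2 ∂μ) * ∫⁻ x, g x ^ 2 ∂μ := by
  have h := ENNReal.lintegral_mul_le_Lp_mul_Lq μ Real.HolderConjugate.two_two hf hg
  simp only [Pi.mul_apply, ENNReal.rpow_two] at h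
  refine (pow_le_pow_left₀ (by positivity) h 2).trans_eq ?_
  rw [mul_pow, ← ENNReal.rpow_natCast, ← ENNReal.rpow_natCast, ← ENNReal.rpow_mul,
    ← ENNReal.rpow_mul]
  norm_num

/-- Interpolation between `L²` and `L⁶`. -/
lemma sq_lintegral_sq_mul_le {α F F' : Type*} [MeasurableSpace α] {μ : Measure α}
    [NormedAddCommGroup F] [NormedAddCommGroup F'] {w : α → F} {G : α → F'}
    (hw : AEStronglyMeasurable w μ) (hG : AEStronglyMeasurable G μ) :
    (∫⁻ x, ‖w x‖ₑ ^ 2 * ‖G x‖ₑ ∂μ) ^ 2 ≤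
      eLpNorm w 2 μ * eLpNorm w 6 μ ^ 3 * eLpNorm G 2 μ ^ 2 := by
  have h2 : ∫⁻ x, ‖w x‖ₑ ^ 2 ∂μ = eLpNorm w 2 μ ^ 2 := by
    have := eLpNorm_nnreal_pow_eq_lintegral (f := w) (μ := μ) (p := 2) (by norm_num)
    simpa using this.symm
  have h2' : ∫⁻ x, ‖G x‖ₑ ^ 2 ∂μ = eLpNorm G 2 μ ^ 2 := by
    have := eLpNorm_nnreal_pow_eq_lintegral (f := G) (μ := μ) (p := 2) (by norm_num)
    simpa using this.symm
  have h6 : ∫⁻ x, ‖w x‖ₑ ^ 6 ∂μ = eLpNorm w 6 μ ^ 6 := by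
    have := eLpNorm_nnreal_pow_eq_lintegral (f := w) (μ := μ) (p := 6) (by norm_num)
    have h := this.symm
    simp only [NNReal.coe_ofNat, ENNReal.coe_ofNat] at h
    exact_mod_cast h
  -- Cauchy–Schwarz for `|w|⁴ = |w| · |w|³`.
  have h4 : (∫⁻ x, ‖w x‖ₑ ^ 4 ∂μ) ^ 2 ≤ (eLpNorm w 2 μ * eLpNorm w 6 μ ^ 3) ^ 2 := by
    have := sq_lintegral_mul_le (μ := μ) hw.enorm (hw.enorm.pow_const 3)
    simp only [← pow_mul, ← pow_succ'] at this
    norm_num at this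
    rw [h2, h6] at this
    exact this.trans_eq (by ring)
  have h4' := (ENNReal.pow_le_pow_left_iff two_ne_zero).1 h4
  have h1 := sq_lintegral_mul_le (μ := μ) (hw.enorm.pow_const 2) hG.enorm
  simp only [← pow_mul] at h1
  norm_num at h1
  rw [h2'] at h1
  exact h1.trans (mul_le_mul_left h4' _)

/-- The estimate of `∫ |v|² |G|` for `v ∈ V`. -/
lemma exists_integral_sq_mul_le (Ω : FluidDomain) : ∃ C : ℝ, 0 ≤ C ∧ ∀ p ∈ graphV Ω,
    ∀ G : Ω.L2 Mat, Integrable (fun x => ‖p.1 x‖ ^ 2 * ‖G x‖) Ω.measure ∧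
      (∫ x, ‖p.1 x‖ ^ 2 * ‖G x‖ ∂Ω.measure) ^ 2 ≤
        C * ‖p.1‖ * (‖p.1‖ + ‖p.2‖) ^ 3 * ‖G‖ ^ 2 := by
  obtain ⟨C, hC⟩ := exists_eLpNorm_six_le_graphV Ω
  refine ⟨(C : ℝ) ^ 3, by positivity, fun p hp G => ?_⟩
  have h1 := sq_lintegral_sq_mul_le (Lp.aestronglyMeasurable p.1) (Lp.aestronglyMeasurable G)
  rw [← Lp.enorm_def, ← Lp.enorm_def] at h1
  have h2 : (∫⁻ x, ‖p.1 x‖ₑ ^ 2 * ‖G x‖ₑ ∂Ω.measure) ^ 2 ≤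
      ‖p.1‖ₑ * (C * (‖p.1‖ₑ + ‖p.2‖ₑ)) ^ 3 * ‖G‖ₑ ^ 2 :=
    h1.trans (by gcongr; exact hC p hp)
  have hfin : ‖p.1‖ₑ * (C * (‖p.1‖ₑ + ‖p.2‖ₑ)) ^ 3 * ‖G‖ₑ ^ 2 ≠ ⊤ := by finiteness
  have hX : ∫⁻ x, ‖p.1 x‖ₑ ^ 2 * ‖G x‖ₑ ∂Ω.measure ≠ ⊤ := by
    intro h
    rw [h] at h2
    exact hfin (top_le_iff.1 (by simpa using h2))
  have hm : AEStronglyMeasurable (fun x => ‖p.1 x‖ ^ 2 * ‖G x‖) Ω.measure :=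
    ((Lp.aestronglyMeasurable p.1).norm.pow 2).mul (Lp.aestronglyMeasurable G).norm
  have he : ∀ x, ‖‖p.1 x‖ ^ 2 * ‖G x‖‖ₑ = ‖p.1 x‖ₑ ^ 2 * ‖G x‖ₑ := fun x => by
    rw [enorm_mul, enorm_pow, enorm_norm, enorm_norm]
  refine ⟨⟨hm, ?_⟩, ?_⟩
  · rw [HasFiniteIntegral]
    simp only [he]
    exact hX.lt_top
  · have hI : ∫ x, ‖p.1 x‖ ^ 2 * ‖G x‖ ∂Ω.measure =
        (∫⁻ x, ‖p.1 x‖ₑ ^ 2 * ‖G x‖ₑ ∂Ω.measure).toReal := by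
      have h := integral_norm_eq_lintegral_enorm hm
      simp only [he] at h
      rw [← h]
      refine integral_congr_ae (Eventually.of_forall fun x => ?_)
      exact (Real.norm_of_nonneg (by positivity)).symm
    have h3 := ENNReal.toReal_mono hfin h2
    rw [hI, ← ENNReal.toReal_pow]
    refine h3.trans_eq ?_
    simp only [ENNReal.toReal_mul, ENNReal.toReal_pow, toReal_enorm,
      ENNReal.toReal_add enorm_ne_top enorm_ne_top, ENNReal.coe_toReal]
    ring

lemma memLp_apply {Ω : FluidDomain} (G : Ω.L2 Mat) (q : Fin 3 × Fin 3) :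
    MemLp (fun x => G x q) 2 Ω.measure :=
  (EuclideanSpace.proj (𝕜 := ℝ) q : Mat →L[ℝ] ℝ).comp_memLp' (Lp.memLp G)

lemma formA_eq_inner (Ω : FluidDomain) (α : ℝ) (G H : Ω.L2 Mat) :
    formA Ω α G H = α * inner ℝ G H := by
  have hint : ∀ i j, Integrable (fun x => G x (i, j) * H x (i, j)) Ω.measure := fun i j =>
    (memLp_apply G (i, j)).integrable_mul (memLp_apply H (i, j))
  rw [formA, L2.inner_def, ← integral_finsetSum _ fun i _ => integrable_finsetSum _ fun j _ => hint i j]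
  congr 2 with x
  rw [PiLp.inner_apply, Fintype.sum_prod_type]
  simp [mul_comm]

/-- The truncated velocity `c y / √(c² + |y|²)`. -/
noncomputable def relVel (c : ℝ) (y : Vec) : Vec := (c / √(c ^ 2 + ‖y‖ ^ 2)) • y

lemma sqrt_add_sq_pos {c : ℝ} (hc : 0 < c) (y : Vec) : 0 < √(c ^ 2 + ‖y‖ ^ 2) :=
  Real.sqrt_pos.2 (by positivity)

lemma norm_le_sqrt_add_sq (c : ℝ) (y : Vec) : ‖y‖ ≤ √(c ^ 2 + ‖y‖ ^ 2) :=
  Real.le_sqrt_of_sq_le (by linarith [sq_nonneg c])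

lemma le_sqrt_add_sq (c : ℝ) (y : Vec) : c ≤ √(c ^ 2 + ‖y‖ ^ 2) :=
  Real.le_sqrt_of_sq_le (by linarith [sq_nonneg ‖y‖])

lemma norm_relVel_le {c : ℝ} (hc : 0 < c) (y : Vec) : ‖relVel c y‖ ≤ c := by
  have h := sqrt_add_sq_pos hc y
  rw [relVel, norm_smul, Real.norm_of_nonneg (by positivity), div_mul_eq_mul_div, div_le_iff₀ h]
  exact mul_le_mul_of_nonneg_left (norm_le_sqrt_add_sq c y) hc.le

/-- With `s`, `t` the square roots at `y`, `z`, the difference is `(c/s)(y - z) + (c/s)((t - s)/t)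
z`. Each term is at most `‖y - z‖`, because `c ≤ s`, `‖z‖ ≤ t` and the square root is 1-Lipschitz in
the velocity. -/
lemma norm_relVel_sub_le {c : ℝ} (hc : 0 < c) (y z : Vec) :
    ‖relVel c y - relVel c z‖ ≤ 2 * ‖y - z‖ := by
  set s := √(c ^ 2 + ‖y‖ ^ 2) with hs
  set t := √(c ^ 2 + ‖z‖ ^ 2) with ht
  have hs0 : 0 < s := sqrt_add_sq_pos hc y
  have ht0 : 0 < t := sqrt_add_sq_pos hc z
  have hcs : c ≤ s := le_sqrt_add_sq c y
  have hzt : ‖z‖ ≤ t := norm_le_sqrt_add_sq c z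
  have hys : ‖y‖ ≤ s := norm_le_sqrt_add_sq c y
  have hst : |t - s| ≤ ‖y - z‖ := by
    have h1 : (t - s) * (t + s) = (‖z‖ - ‖y‖) * (‖z‖ + ‖y‖) := by
      have e1 : t ^ 2 = c ^ 2 + ‖z‖ ^ 2 := Real.sq_sqrt (by positivity)
      have e2 : s ^ 2 = c ^ 2 + ‖y‖ ^ 2 := Real.sq_sqrt (by positivity)
      linear_combination e1 - e2
    have h2 : |t - s| * (t + s) = |‖z‖ - ‖y‖| * (‖z‖ + ‖y‖) := by
      have := congrArg abs h1
      rwa [abs_mul, abs_mul, abs_of_pos (by linarith : 0 < t + s),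
        abs_of_nonneg (by positivity : 0 ≤ ‖z‖ + ‖y‖)] at this
    have h3 : |‖z‖ - ‖y‖| * (‖z‖ + ‖y‖) ≤ ‖y - z‖ * (t + s) := by
      rw [norm_sub_rev]
      exact mul_le_mul (abs_norm_sub_norm_le _ _) (by linarith) (by positivity) (norm_nonneg _)
    rw [← h2] at h3
    exact le_of_mul_le_mul_right h3 (by linarith)
  have heq : relVel c y - relVel c z = (c / s) • (y - z) + ((c / s) * ((t - s) / t)) • z := by
    have hk : (c / s) * ((t - s) / t) = c / s - c / t := by field_simp
    simp only [relVel, ← hs, ← ht, hk]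
    module
  have hcs' : c / s ≤ 1 := (div_le_one hs0).2 hcs
  have h1 : ‖(c / s) • (y - z)‖ ≤ ‖y - z‖ := by
    rw [norm_smul, Real.norm_of_nonneg (by positivity)]
    exact mul_le_of_le_one_left (norm_nonneg _) hcs'
  have h2 : ‖((c / s) * ((t - s) / t)) • z‖ ≤ ‖y - z‖ := by
    rw [norm_smul, norm_mul, Real.norm_of_nonneg (by positivity : 0 ≤ c / s), Real.norm_eq_abs,
      abs_div, abs_of_pos ht0, mul_assoc]
    refine (mul_le_of_le_one_left (by positivity) hcs').trans ?_
    rw [div_mul_eq_mul_div, div_le_iff₀ ht0]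
    exact mul_le_mul hst hzt (norm_nonneg _) (norm_nonneg _)
  rw [heq]
  linarith [norm_add_le ((c / s) • (y - z)) (((c / s) * ((t - s) / t)) • z)]

lemma continuous_relVel {c : ℝ} (hc : 0 < c) : Continuous (relVel c) := by
  have h : Continuous fun y : Vec => √(c ^ 2 + ‖y‖ ^ 2) := by fun_prop
  exact (continuous_const.div h fun y => (sqrt_add_sq_pos hc y).ne').smul continuous_id

/-- The integrand of `formB` at a point, with the transporting velocity already truncated. -/
noncomputable def transport (y : Vec) (G : Mat) (v : Vec) : ℝ := ∑ i, ∑ j, y j * G (i, j) * v i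

lemma continuous_transport :
    Continuous fun p : Vec × Mat × Vec => transport p.1 p.2.1 p.2.2 := by
  unfold transport
  fun_prop

lemma formB_eq (Ω : FluidDomain) (c : ℝ) (y : Ω.L2 Vec) (G : Ω.L2 Mat) (v : Ω.L2 Vec) :
    formB Ω c y G v = ∫ x, transport (relVel c (y x)) (G x) (v x) ∂Ω.measure := by
  unfold formB transport relVel
  congr 1 with x
  refine Finset.sum_congr rfl fun i _ => Finset.sum_congr rfl fun j _ => ?_
  simp only [PiLp.smul_apply, smul_eq_mul]
  ring

lemma integrable_norm_mul_norm {Ω : FluidDomain} (G : Ω.L2 Mat) (v : Ω.L2 Vec) :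
    Integrable (fun x => ‖G x‖ * ‖v x‖) Ω.measure :=
  (Lp.memLp G).norm.integrable_mul (Lp.memLp v).norm

lemma integral_norm_mul_norm_le {Ω : FluidDomain} (G : Ω.L2 Mat) (v : Ω.L2 Vec) :
    ∫ x, ‖G x‖ * ‖v x‖ ∂Ω.measure ≤ ‖G‖ * ‖v‖ := by
  have h2 : ∀ {F : Type} [NormedAddCommGroup F] [InnerProductSpace ℝ F] (f : Ω.L2 F),
      (∫ x, ‖f x‖ ^ (2 : ℝ) ∂Ω.measure) ^ (1 / 2 : ℝ) = ‖f‖ := by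
    intro F _ _ f
    have : ∫ x, ‖f x‖ ^ (2 : ℝ) ∂Ω.measure = ‖f‖ ^ 2 := by
      rw [← real_inner_self_eq_norm_sq, L2.inner_def]
      simp
    rw [this, ← Real.sqrt_eq_rpow, Real.sqrt_sq (norm_nonneg _)]
  have := integral_mul_norm_le_Lp_mul_Lq (μ := Ω.measure) (f := fun x => ‖G x‖)
    (g := fun x => ‖v x‖) Real.HolderConjugate.two_two (by simpa using (Lp.memLp G).norm)
    (by simpa using (Lp.memLp v).norm)
  simp only [norm_norm] at this
  rwa [h2, h2] at this

lemma integrable_transport {Ω : FluidDomain} {c : ℝ} (hc : 0 < c) (y : Ω.L2 Vec) (G : Ω.L2 Mat)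
    (v : Ω.L2 Vec) :
    Integrable (fun x => transport (relVel c (y x)) (G x) (v x)) Ω.measure := by
  refine Integrable.mono' ((integrable_norm_mul_norm G v).const_mul c) ?_ ?_
  · have hy : AEStronglyMeasurable (fun x => relVel c (y x)) Ω.measure :=
      (continuous_relVel hc).comp_aestronglyMeasurable (Lp.aestronglyMeasurable y)
    have hG : AEStronglyMeasurable (fun x => G x) Ω.measure := Lp.aestronglyMeasurable G
    have hv : AEStronglyMeasurable (fun x => v x) Ω.measure := Lp.aestronglyMeasurable v
    have hp : AEStronglyMeasurable (fun x => (relVel c (y x), G x, v x)) Ω.measure :=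
      hy.prodMk (hG.prodMk hv)
    have := continuous_transport.comp_aestronglyMeasurable hp
    exact this
  · refine Eventually.of_forall fun x => ?_
    rw [Real.norm_eq_abs]
    refine (abs_sum_mul_mul_le _ _ _).trans ?_
    rw [mul_assoc]
    exact mul_le_mul_of_nonneg_right (norm_relVel_le hc _) (by positivity)

/-- The difference of the convective terms of two velocities, tested with their difference. -/
lemma abs_formB_sub_le {Ω : FluidDomain} {c : ℝ} (hc : 0 < c) (y z : Ω.L2 Vec) (G H : Ω.L2 Mat)
    (hint : Integrable (fun x => ‖(y - z) x‖ ^ 2 * ‖H x‖) Ω.measure) :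
    |formB Ω c y G (y - z) - formB Ω c z H (y - z)| ≤
      c * (‖G - H‖ * ‖y - z‖) + 2 * ∫ x, ‖(y - z) x‖ ^ 2 * ‖H x‖ ∂Ω.measure := by
  rw [formB_eq, formB_eq, ← integral_sub (integrable_transport hc y G _)
    (integrable_transport hc z H _), ← Real.norm_eq_abs]
  have hI1 := (integrable_norm_mul_norm (G - H) (y - z)).const_mul c
  have hI2 := hint.const_mul 2
  refine (norm_integral_le_of_norm_le (hI1.add hI2) ?_).trans ?_
  · filter_upwards [Lp.coeFn_sub y z, Lp.coeFn_sub G H] with x h1 h2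
    -- Adding and subtracting `relVel c (y x)` acting on `H` leaves one term with `G - H` and one
    -- with the difference of velocities, the latter quadratic in `y - z`.
    have hsplit : transport (relVel c (y x)) (G x) ((y - z) x)
        - transport (relVel c (z x)) (H x) ((y - z) x)
        = transport (relVel c (y x)) ((G - H) x) ((y - z) x)
          + transport (relVel c (y x) - relVel c (z x)) (H x) ((y - z) x) := by
      rw [h2]
      simp only [transport, ← Finset.sum_add_distrib, ← Finset.sum_sub_distrib]
      refine Finset.sum_congr rfl fun i _ => Finset.sum_congr rfl fun j _ => ?_
      simp only [Pi.sub_apply, PiLp.sub_apply]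
      ring
    rw [hsplit]
    refine (norm_add_le _ _).trans (add_le_add ?_ ?_)
    · rw [Real.norm_eq_abs]
      refine (abs_sum_mul_mul_le _ _ _).trans ?_
      rw [mul_assoc]
      exact mul_le_mul_of_nonneg_right (norm_relVel_le hc _) (by positivity)
    · rw [Real.norm_eq_abs]
      refine (abs_sum_mul_mul_le _ _ _).trans ?_
      have h3 := norm_relVel_sub_le hc (y x) (z x)
      have h4 : (y - z) x = y x - z x := h1
      rw [← h4] at h3
      calc _ ≤ 2 * ‖(y - z) x‖ * ‖H x‖ * ‖(y - z) x‖ := by gcongr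
        _ = _ := by ring
  · simp only [Pi.add_apply]
    rw [integral_add hI1 hI2, integral_const_mul, integral_const_mul]
    gcongr
    exact integral_norm_mul_norm_le _ _

end Forms
end QRNS

namespace QRNS
open Filter Topology Set
open scoped NNReal

/-! ### The energy estimate and the conclusion. -/

section Uniqueness

lemma partialDeriv_sub {φ ψ : Vec → Vec} (hφ : ContDiff ℝ ∞ φ) (hψ : ContDiff ℝ ∞ ψ) (j : Fin 3)
    (x : Vec) : partialDeriv j (φ - ψ) x = partialDeriv j φ x - partialDeriv j ψ x := by
  unfold partialDeriv
  rw [fderiv_sub (hφ.differentiable (by simp) x) (hψ.differentiable (by simp) x)]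
  rfl

lemma FluidDomain.IsTest.contDiff {Ω : FluidDomain} {φ : Vec → Vec} (h : Ω.IsTest φ) :
    ContDiff ℝ ∞ φ := by
  cases Ω <;> exact h.1

lemma FluidDomain.IsTest.sub {Ω : FluidDomain} {φ ψ : Vec → Vec} (hφ : Ω.IsTest φ)
    (hψ : Ω.IsTest ψ) : Ω.IsTest (φ - ψ) := by
  cases Ω with
  | bounded U hU =>
    obtain ⟨h1, h2, h3⟩ := hφ
    obtain ⟨k1, k2, k3⟩ := hψ
    exact ⟨h1.sub k1, h2.sub k2, (tsupport_sub φ ψ).trans (union_subset h3 k3)⟩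
  | torus =>
    obtain ⟨h1, h2⟩ := hφ
    obtain ⟨k1, k2⟩ := hψ
    refine ⟨h1.sub k1, fun x i => ?_⟩
    simp only [Pi.sub_apply, h2, k2]

/-- This makes the difference of two solutions an admissible test field, paired with the difference
of their gradients. -/
lemma sub_mem_graphV {Ω : FluidDomain} {p q : Ω.L2 Vec × Ω.L2 Mat} (hp : p ∈ graphV Ω)
    (hq : q ∈ graphV Ω) : p - q ∈ graphV Ω := by
  refine map_mem_closure₂ continuous_sub hp hq ?_
  rintro a ⟨φ, hφ, hφd, e1, e2⟩ b ⟨ψ, hψ, hψd, k1, k2⟩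
  refine ⟨φ - ψ, hφ.sub hψ, fun x => ?_, ?_, ?_⟩
  · have h := hφd x
    have k := hψd x
    unfold div at h k ⊢
    simp only [partialDeriv_sub hφ.contDiff hψ.contDiff, PiLp.sub_apply, Finset.sum_sub_distrib, h, k,
      sub_zero]
  · exact (Lp.coeFn_sub a.1 b.1).trans (e1.sub k1)
  · refine (Lp.coeFn_sub a.2 b.2).trans ((e2.sub k2).trans (Eventually.of_forall fun x => ?_))
    ext q
    simp only [Pi.sub_apply, PiLp.sub_apply, grad, partialDeriv_sub hφ.contDiff hψ.contDiff]

/-- Absorption of the convective terms by the viscous one. -/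
lemma add_le_of_sq_le {α c Q a b X : ℝ} (hα : 0 < α)
    (h : X ^ 2 ≤ Q * a * (a + b) ^ 3) :
    c * (b * a) + 2 * X ≤
      α * b ^ 2 + (c ^ 2 / (2 * α) + α / 4 + 2 * (Q ^ 2 / (α / 16) ^ 3)) * a ^ 2 := by
  -- With this choice `2 ε S² ≤ (α/4)(a² + b²)`; the term `c b a` costs a further `(α/2) b²`, so the
  -- total stays below `α b²`.
  set ε := α / 16 with hε
  have hε0 : 0 < ε := by positivity
  set S := a + b with hS
  set Y := ε * S ^ 2 + Q ^ 2 / ε ^ 3 * a ^ 2 with hY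
  have hY0 : 0 ≤ Y := by positivity
  have hX : X ≤ Y := by
    refine (le_abs_self X).trans (abs_le_of_sq_le_sq (h.trans ?_) hY0)
    -- Young's inequality for the product `(ε S)(Q a / ε)`.
    have h1 : Q * a * S ≤ ε * Y := by
      have h2 : ε * Y = (ε * S) ^ 2 + (Q * a / ε) ^ 2 := by
        rw [hY]; field_simp
      have h3 : Q * a * S = (ε * S) * (Q * a / ε) := by field_simp
      rw [h2, h3]
      nlinarith [sq_nonneg (ε * S - Q * a / ε), sq_nonneg (ε * S), sq_nonneg (Q * a / ε)]
    have h4 : ε * S ^ 2 ≤ Y := by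
      rw [hY]
      have : 0 ≤ Q ^ 2 / ε ^ 3 * a ^ 2 := by positivity
      linarith
    calc Q * a * S ^ 3 = S ^ 2 * (Q * a * S) := by ring
      _ ≤ S ^ 2 * (ε * Y) := mul_le_mul_of_nonneg_left h1 (by positivity)
      _ = (ε * S ^ 2) * Y := by ring
      _ ≤ Y * Y := mul_le_mul_of_nonneg_right h4 hY0
      _ = Y ^ 2 := by ring
  have h5 : c * (b * a) ≤ α / 2 * b ^ 2 + c ^ 2 / (2 * α) * a ^ 2 := by
    have : α / 2 * b ^ 2 + c ^ 2 / (2 * α) * a ^ 2 - c * (b * a) = (α * b - c * a) ^ 2 / (2 * α) := by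
      field_simp
      ring
    have h6 : 0 ≤ (α * b - c * a) ^ 2 / (2 * α) := by positivity
    linarith
  have h7 : ε * S ^ 2 ≤ α / 8 * a ^ 2 + α / 8 * b ^ 2 := by
    rw [hε, hS]
    nlinarith [mul_nonneg hα.le (sq_nonneg (a - b))]
  have h8 : 0 ≤ α * b ^ 2 := by positivity
  linarith

/-- The energy estimate for the difference of two solutions of the weak equation at one time. -/
lemma exists_inner_le {Ω : FluidDomain} {α c : ℝ} (hα : 0 < α) (hc : 0 < c) (M : ℝ) :
    ∃ K : ℝ, ∀ (y z y' z' g : Ω.L2 Vec) (G H : Ω.L2 Mat),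
      (y, G) ∈ graphV Ω → (z, H) ∈ graphV Ω → ‖H‖ ≤ M →
      (∀ (v : Ω.L2 Vec) (Gv : Ω.L2 Mat), (v, Gv) ∈ graphV Ω →
        inner ℝ y' v + formA Ω α G Gv + formB Ω c y G v = inner ℝ g v) →
      (∀ (v : Ω.L2 Vec) (Gv : Ω.L2 Mat), (v, Gv) ∈ graphV Ω →
        inner ℝ z' v + formA Ω α H Gv + formB Ω c z H v = inner ℝ g v) →
      inner ℝ (y - z) (y' - z') ≤ K * ‖y - z‖ ^ 2 := by
  obtain ⟨C, hC, hCb⟩ := exists_integral_sq_mul_le Ω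
  -- The constant of `add_le_of_sq_le` with `Q = C M²`. It depends on the fields only through `M`,
  -- hence is uniform in time.
  refine ⟨c ^ 2 / (2 * α) + α / 4 + 2 * ((C * M ^ 2) ^ 2 / (α / 16) ^ 3), ?_⟩
  intro y z y' z' g G H hy hz hM e1 e2
  have hmem : (y - z, G - H) ∈ graphV Ω := sub_mem_graphV hy hz
  obtain ⟨hint, hsq⟩ := hCb _ hmem H
  have hB := abs_formB_sub_le hc y z G H hint
  have h1 := e1 _ _ hmem
  have h2 := e2 _ _ hmem
  rw [formA_eq_inner] at h1 h2
  have hI : inner ℝ (y - z) (y' - z') = inner ℝ y' (y - z) - inner ℝ z' (y - z) := by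
    rw [real_inner_comm, inner_sub_left]
  have hD : inner ℝ G (G - H) - inner ℝ H (G - H) = ‖G - H‖ ^ 2 := by
    rw [← inner_sub_left, real_inner_self_eq_norm_sq]
  have hsq' : (∫ x, ‖(y - z) x‖ ^ 2 * ‖H x‖ ∂Ω.measure) ^ 2 ≤
      C * M ^ 2 * ‖y - z‖ * (‖y - z‖ + ‖G - H‖) ^ 3 := by
    refine hsq.trans ?_
    have : ‖H‖ ^ 2 ≤ M ^ 2 := pow_le_pow_left₀ (norm_nonneg _) hM 2
    calc _ ≤ C * ‖y - z‖ * (‖y - z‖ + ‖G - H‖) ^ 3 * M ^ 2 :=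
          mul_le_mul_of_nonneg_left this (by positivity)
      _ = _ := by ring
  have habs := add_le_of_sq_le (c := c) hα hsq'
  have hB' := (neg_le_abs _).trans hB
  have hD' : α * inner ℝ G (G - H) - α * inner ℝ H (G - H) = α * ‖G - H‖ ^ 2 := by
    rw [← mul_sub, hD]
  rw [hI]
  linarith

lemma ae_timeMeasure_iff {T : ℝ} {P : ℝ → Prop} :
    (∀ᵐ t ∂timeMeasure T, P t) ↔ ∀ᵐ t, t ∈ Ioo 0 T → P t :=
  ae_restrict_iff' measurableSet_Ioo

lemma ae_norm_le_of_memLp_top {Ω : FluidDomain} {T : ℝ} {G : ℝ → Ω.L2 Mat}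
    (hG : MemLp G ∞ (timeMeasure T)) : ∃ M : ℝ, ∀ᵐ t ∂timeMeasure T, ‖G t‖ ≤ M := by
  have hfin := hG.eLpNorm_lt_top
  refine ⟨(eLpNorm G ⊤ (timeMeasure T)).toReal, ?_⟩
  have h : ∀ᵐ t ∂timeMeasure T, ‖G t‖ₑ ≤ eLpNorm G ⊤ (timeMeasure T) := by
    rw [eLpNorm_exponent_top]
    exact enorm_ae_le_eLpNormEssSup G _
  filter_upwards [h] with t ht
  rw [← toReal_enorm]
  exact ENNReal.toReal_mono hfin.ne ht

end Uniqueness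
end QRNS

theorem mainTheorem4 (Ω : QRNS.FluidDomain) (T α c : ℝ) (hT : 0 < T) (hα : 0 < α) (hc : 0 < c)
    (f : ℝ → Ω.L2 QRNS.Vec) (hf : MemLp f 2 (QRNS.timeMeasure T))
    (u₀ : Ω.L2 QRNS.Vec) (hu₀ : u₀ ∈ QRNS.V Ω)
    (u₁ u₂ : ℝ → Ω.L2 QRNS.Vec)
    (h₁ : QRNS.IsStrongSolution Ω T α c f u₀ u₁)
    (h₂ : QRNS.IsStrongSolution Ω T α c f u₀ u₂) :
    ∀ t ∈ Set.Icc 0 T, u₁ t = u₂ t := by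
  obtain ⟨G₁, u₁', hV₁, hu₁', hd₁, he₁⟩ := h₁.weak_form
  obtain ⟨G₂, u₂', hV₂, hu₂', hd₂, he₂⟩ := h₂.weak_form
  have : IsFiniteMeasure (QRNS.timeMeasure T) := by unfold QRNS.timeMeasure; infer_instance
  have hi₁ : IntegrableOn u₁' (Set.Ioo 0 T) := hu₁'.integrable one_le_two
  have hi₂ : IntegrableOn u₂' (Set.Ioo 0 T) := hu₂'.integrable one_le_two
  have hw₁ := QRNS.eq_add_integral_of_weakDeriv hT h₁.continuousOn hi₁ hd₁
  have hw₂ := QRNS.eq_add_integral_of_weakDeriv hT h₂.continuousOn hi₂ hd₂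
  have hI₁ : IntervalIntegrable u₁' volume 0 T :=
    (intervalIntegrable_iff_integrableOn_Ioo_of_le hT.le).2 hi₁
  have hI₂ : IntervalIntegrable u₂' volume 0 T :=
    (intervalIntegrable_iff_integrableOn_Ioo_of_le hT.le).2 hi₂
  have hw : ∀ t ∈ Set.Icc 0 T,
      u₁ t - u₂ t = (u₁ 0 - u₂ 0) + ∫ τ in (0 : ℝ)..t, (u₁' τ - u₂' τ) := by
    intro t ht
    have hsub : Set.uIcc 0 t ⊆ Set.uIcc 0 T := by
      rw [Set.uIcc_of_le ht.1, Set.uIcc_of_le hT.le]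
      exact Set.Icc_subset_Icc_right ht.2
    rw [intervalIntegral.integral_sub (hI₁.mono_set hsub) (hI₂.mono_set hsub), hw₁ t ht, hw₂ t ht]
    abel
  have hAC := QRNS.absolutelyContinuousOnInterval_norm_sq (w := fun t => u₁ t - u₂ t) hT (hI₁.sub hI₂) hw
  have hderiv := QRNS.ae_hasDerivAt_norm_sq (w := fun t => u₁ t - u₂ t) hT (hI₁.sub hI₂) hw
  -- The splitting of the convective terms puts only the gradient of `u₂` into the constant.
  obtain ⟨M, hM⟩ := QRNS.ae_norm_le_of_memLp_top hV₂.memLp_grad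
  obtain ⟨K, hK⟩ := QRNS.exists_inner_le (Ω := Ω) hα hc M
  have hle : ∀ t ∈ Set.Icc 0 T, ‖u₁ t - u₂ t‖ ^ 2 ≤ 0 := by
    -- The factor `2` comes from `d/dt ‖w‖² = 2 (w, w')`.
    refine QRNS.nonpos_of_ae_deriv_le (K := 2 * K) hT hAC (by simp [h₁.initial, h₂.initial]) ?_
    filter_upwards [hderiv, QRNS.ae_timeMeasure_iff.1 hM, QRNS.ae_timeMeasure_iff.1 hV₁.mem_graph,
      QRNS.ae_timeMeasure_iff.1 hV₂.mem_graph, QRNS.ae_timeMeasure_iff.1 he₁, QRNS.ae_timeMeasure_iff.1 he₂]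
      with t a1 a2 a3 a4 a5 a6 ht
    rw [(a1 ht).deriv]
    have := hK _ _ _ _ _ _ _ (a3 ht) (a4 ht) (a2 ht) (a5 ht) (a6 ht)
    linarith
  intro t ht
  exact sub_eq_zero.1 (norm_eq_zero.1 (pow_eq_zero_iff two_ne_zero |>.1
    (le_antisymm (hle t ht) (sq_nonneg _))))
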